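/- For integers $n, r \ge 2$ put $R(r,n) = r\log n\cdot\log^2 r\cdot\log(r\log n)$. Call $f\in\mathbb{C}^n$ $r$-sparse if it has at most $r$ nonzero coordinates, and write $\|f\|_1=\sum_{j}|f_j|$. For an $n\times n$ complex matrix $\Psi$, with rows and columns indexed by $\{0,\dots,n-1\}$, and a set $\Omega\subseteq\{0,\dots,n-1\}$, say that $\Omega$ recovers $r$-sparse signals through $\Psi$ if every $r$-sparse $f\in\mathbb{C}^n$ is the unique solution of the program $$\text{minimize } \|f^*\|_1 \text{ over } f^*\in\mathbb{C}^n \text{ subject to } (\Psi f^*)(\omega) = (\Psi f)(\omega)\quad\text{for all } \omega\in\Omega .$$ (1) There are an absolute constant $C>0$ and a sequence $p(n)\to 1$ such that for all integers $n,r\ge 2$ and $k\le n$ with $k\ge C\,R(r,n)$, a uniformly random $k$-element subset $\Omega$ of $\{0,\dots,n-1\}$ recovers $r$-sparse signals through the DFT matrix $\Psi_{\omega,t} = n^{-1/2}\exp(-2\pi i\omega t/n)$ with probability at least $p(n)$. (2) More generally, for every $K$ there are a constant $C>0$ and a sequence $p(n)\to 1$, depending only on $K$, such that for all integers $n,r\ge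 2$ and $k\le n$ with $k\ge C\,R(r,n)$, and for every unitary $n\times n$ matrix $\Psi$ whose entries all have modulus at most $K/\sqrt{n}$, a uniformly random $k$-element subset $\Omega$ of $\{0,\dots,n-1\}$ recovers $r$-sparse signals through $\Psi$ with probability at least $p(n)$. -/

import Mathlib

open Filter Topology

noncomputable section

/-- The discrete Fourier transform matrix, with entries `n^(-1/2) * exp (-2 π i ω t / n)`. -/
def dftMatrix (n : ℕ) : Matrix (Fin n) (Fin n) ℂ :=
  Matrix.of fun ω t =>
    (1 / (Real.sqrt n : ℂ)) *
      Complex.exp (-(Complex.I * 2 * Real.pi * ((ω : ℕ) : ℂ) * ((t : ℕ) : ℂ) / (n : ℂ)))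

/-- The `ℓ₁` norm of a complex vector. -/
def l1Norm {n : ℕ} (f : Fin n → ℂ) : ℝ := ∑ i, ‖f i‖

/-- `f` has at most `r` nonzero coordinates. -/
def IsSparse {n : ℕ} (r : ℕ) (f : Fin n → ℂ) : Prop := {i | f i ≠ 0}.ncard ≤ r

/-- `g` satisfies the measurement constraints `(Ψ g)(ω) = (Ψ f)(ω)` for all `ω ∈ Ω`. -/
def IsFeasible {n : ℕ} (Ψ : Matrix (Fin n) (Fin n) ℂ) (Ω : Finset (Fin n))
    (f g : Fin n → ℂ) : Prop :=
  ∀ ω ∈ Ω, Ψ.mulVec g ω = Ψ.mulVec f ω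

/-- `g` solves the program: minimize the `ℓ₁` norm of `h` subject to
`(Ψ h)(ω) = (Ψ f)(ω)` for all `ω ∈ Ω`. -/
def IsL1Solution {n : ℕ} (Ψ : Matrix (Fin n) (Fin n) ℂ) (Ω : Finset (Fin n))
    (f g : Fin n → ℂ) : Prop :=
  IsFeasible Ψ Ω f g ∧ ∀ h, IsFeasible Ψ Ω f h → l1Norm g ≤ l1Norm h

/-- Every `r`-sparse signal `f` is the unique solution of its `ℓ₁` program. -/
def RecoversSparse {n : ℕ} (Ψ : Matrix (Fin n) (Fin n) ℂ) (r : ℕ) (Ω : Finset (Fin n)) : Prop :=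
  ∀ f : Fin n → ℂ, IsSparse r f → ∀ g, IsL1Solution Ψ Ω f g ↔ g = f

open Classical in
/-- The probability that a set `Ω`, uniformly distributed among the `k`-element subsets of
`{0, …, n - 1}`, has the property `P` (used for `k ≤ n` only). -/
def probSubset (n k : ℕ) (P : Finset (Fin n) → Prop) : ℝ :=
  (((Finset.univ : Finset (Fin n)).powersetCard k).filter P).card / (n.choose k : ℝ)

/-- The rate `r log n · log² r · log (r log n)`. -/
def sampleRate (r n : ℕ) : ℝ :=
  (r * Real.log n) * Real.log r ^ 2 * Real.log (r * Real.log n)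

end

/-! By `recoversSparse_of_kernel` it suffices that no nonzero `h` with `‖h‖₁ ≤ 2√r ‖h‖₂` satisfies
`Ψ h = 0` on `Ω`. Normalise `‖h‖₂ = 1` and put `F = √n Ψ h`. Unitarity gives `F` mean square 1, and
the entry bound gives `|F| ≤ 2√r K < 2^I` with `I` of order `log r`. Hence at some dyadic level `i ≤
I`, `|F| ≥ 2^i/2` on a proportion `2q` of the coordinates, where `q = 1/(4·4^i (I+1))`
(`exists_level`).

Maurey's empirical method replaces `F` by a member of a finite family. The vector `h` is a convex
combination of `4n+1` atoms, and an average `G` of `L` of order `r K² (I+1)/4^i` atoms is within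
`2^i/4` of `F`, except on a small proportion of the population and of the sample
(`exists_average_approx`). Because exceptions are allowed, `L` carries no factor `log n`. There are
only `(4n+1)^L` averages, so Chernoff and a union bound show that with high probability each average
that is large on a proportion `q` of the population is large at more than `kq/4` sample points
(`card_not_sample_large_le`). One of these points is not exceptional, and there `F ≠ 0`
(`exists_sample_ne_zero`).

The union bound needs `kq ≳ L log n`. The powers of 4 cancel, leaving `k ≳ r K² (I+1)² log n`, of
order `r log² r log n`; the factor `log(r log n)` is only bounded below by a constant. -/

/-! ### Concentration inequalities and Maurey's empirical method. -/

/-- A bounded centred finite random variable has a sub-Gaussian moment generating function. -/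
theorem sum_mul_exp_le_exp_sq {V : Type*} [Fintype V] {w y : V → ℝ} {a : ℝ} (ha : 0 < a)
    (hw : ∀ v, 0 ≤ w v) (hw1 : ∑ v, w v = 1) (hy : ∀ v, |y v| ≤ a)
    (hmean : ∑ v, w v * y v = 0) (c : ℝ) :
    ∑ v, w v * Real.exp (c * y v) ≤ Real.exp ((c * a) ^ 2 / 2) := by
  -- Convexity: on `[-a, a]` the exponential lies below its chord.
  have hpt : ∀ v, Real.exp (c * y v) ≤ Real.cosh (c * a) + y v / a * Real.sinh (c * a) := by
    intro v
    have h1 : |y v / a| ≤ 1 := by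
      rw [abs_div, abs_of_pos ha]
      exact (div_le_one ha).2 (hy v)
    have h2 := Real.exp_mul_le_cosh_add_mul_sinh h1 (c * a)
    have h3 : y v / a * (c * a) = c * y v := by field_simp
    rwa [h3] at h2
  calc ∑ v, w v * Real.exp (c * y v)
      ≤ ∑ v, w v * (Real.cosh (c * a) + y v / a * Real.sinh (c * a)) :=
        Finset.sum_le_sum fun v _ => mul_le_mul_of_nonneg_left (hpt v) (hw v)
    _ = (∑ v, w v) * Real.cosh (c * a) + (∑ v, w v * y v) * (Real.sinh (c * a) / a) := by
        rw [Finset.sum_mul, Finset.sum_mul, ← Finset.sum_add_distrib]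
        refine Finset.sum_congr rfl fun v _ => ?_
        field_simp
    _ = Real.cosh (c * a) := by rw [hw1, hmean]; ring
    _ ≤ _ := Real.cosh_le_exp_half_sq _

open Classical in
/-- Hoeffding's inequality for a finite product distribution. -/
theorem hoeffding_centered {V : Type*} [Fintype V] {w y : V → ℝ} {a s : ℝ} (ha : 0 < a)
    (hw : ∀ v, 0 ≤ w v) (hw1 : ∑ v, w v = 1) (hy : ∀ v, |y v| ≤ a)
    (hmean : ∑ v, w v * y v = 0) (hs : 0 ≤ s) (L : ℕ) :
    ∑ X : Fin L → V, (∏ l, w (X l)) * (if L * s ≤ ∑ l, y (X l) then 1 else 0)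
      ≤ Real.exp (-(L * s ^ 2 / (2 * a ^ 2))) := by
  -- This `c` minimises the Chernoff exponent `-c L s + L (c a)² / 2`.
  set c := s / a ^ 2 with hc
  have hc0 : 0 ≤ c := by positivity
  calc ∑ X : Fin L → V, (∏ l, w (X l)) * (if L * s ≤ ∑ l, y (X l) then (1 : ℝ) else 0)
      ≤ ∑ X : Fin L → V, Real.exp (-(c * (L * s))) * ∏ l, (w (X l) * Real.exp (c * y (X l))) := by
        refine Finset.sum_le_sum fun X _ => ?_
        rw [Finset.prod_mul_distrib, ← Real.exp_sum, ← Finset.mul_sum, mul_left_comm,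
          ← Real.exp_add]
        refine mul_le_mul_of_nonneg_left ?_ (Finset.prod_nonneg fun l _ => hw _)
        split_ifs with h
        · rw [← Real.exp_zero]
          refine Real.exp_le_exp.2 ?_
          nlinarith [mul_le_mul_of_nonneg_left h hc0]
        · positivity
    _ = Real.exp (-(c * (L * s))) * (∑ v, w v * Real.exp (c * y v)) ^ L := by
        rw [Fintype.sum_pow, Finset.mul_sum]
    _ ≤ Real.exp (-(c * (L * s))) * (Real.exp ((c * a) ^ 2 / 2)) ^ L := by
        gcongr
        · exact Finset.sum_nonneg fun v _ => mul_nonneg (hw v) (Real.exp_nonneg _)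
        · exact sum_mul_exp_le_exp_sq ha hw hw1 hy hmean c
    _ = _ := by
        rw [← Real.exp_nat_mul, ← Real.exp_add, hc]
        congr 1
        field_simp
        ring

open Classical in
/-- Two-sided Hoeffding inequality for complex random variables, with a crude constant. -/
theorem hoeffding_complex {V : Type*} [Fintype V] {w : V → ℝ} {z : V → ℂ} {b τ : ℝ} (hb : 0 < b)
    (hw : ∀ v, 0 ≤ w v) (hw1 : ∑ v, w v = 1) (hz : ∀ v, ‖z v‖ ≤ b) (hτ : 0 ≤ τ)
    {L : ℕ} (hL : 0 < L) :
    ∑ X : Fin L → V, (∏ l, w (X l)) *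
        (if τ ≤ ‖∑ v, (w v : ℂ) * z v - (∑ l, z (X l)) / L‖ then 1 else 0)
      ≤ 4 * Real.exp (-(L * τ ^ 2 / (32 * b ^ 2))) := by
  set m := ∑ v, (w v : ℂ) * z v with hm
  have hL' : (0 : ℝ) < L := by exact_mod_cast hL
  have hmb : ‖m‖ ≤ b := by
    calc ‖m‖ ≤ ∑ v, ‖(w v : ℂ) * z v‖ := norm_sum_le _ _
      _ ≤ ∑ v, w v * b := Finset.sum_le_sum fun v _ => by
          rw [norm_mul, Complex.norm_real, Real.norm_of_nonneg (hw v)]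
          exact mul_le_mul_of_nonneg_left (hz v) (hw v)
      _ = b := by rw [← Finset.sum_mul, hw1, one_mul]
  have hdiff : ∀ v, ‖z v - m‖ ≤ 2 * b := fun v => by
    linarith [norm_sub_le (z v) m, hz v]
  have hmean : ∑ v, (w v : ℂ) * (z v - m) = 0 := by
    simp_rw [mul_sub]
    rw [Finset.sum_sub_distrib, ← Finset.sum_mul, ← Complex.ofReal_sum, hw1]
    simp [hm]
  have key : ∀ φ : ℂ →ₗ[ℝ] ℝ, (∀ u, |φ u| ≤ ‖u‖) →
      ∑ X : Fin L → V, (∏ l, w (X l)) * (if L * (τ / 2) ≤ ∑ l, φ (z (X l) - m) then 1 else 0)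
      ≤ Real.exp (-(L * τ ^ 2 / (32 * b ^ 2))) := by
    intro φ hφ
    -- Centring doubles the bound to `2b`, and one of `|Re|`, `|Im|` carries at least half the
    -- deviation; hence `32 = 2 · 2² · 2²`.
    have := hoeffding_centered (w := w) (y := fun v => φ (z v - m)) (a := 2 * b) (s := τ / 2)
      (by positivity) hw hw1 (fun v => (hφ _).trans (hdiff v)) (by
        have h := congrArg φ hmean
        rw [map_sum, map_zero] at h
        rw [← h]
        refine Finset.sum_congr rfl fun v _ => ?_
        rw [← Complex.real_smul, map_smul, smul_eq_mul]) (by positivity) L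
    refine this.trans (le_of_eq ?_)
    congr 2
    field_simp
    ring
  have h1 := key Complex.reLm (fun u => Complex.abs_re_le_norm u)
  have h2 := key (-Complex.reLm) (fun u => by simpa using Complex.abs_re_le_norm u)
  have h3 := key Complex.imLm (fun u => Complex.abs_im_le_norm u)
  have h4 := key (-Complex.imLm) (fun u => by simpa using Complex.abs_im_le_norm u)
  have hsum := add_le_add (add_le_add h1 h2) (add_le_add h3 h4)
  rw [← Finset.sum_add_distrib, ← Finset.sum_add_distrib, ← Finset.sum_add_distrib] at hsum
  refine le_trans (Finset.sum_le_sum fun X _ => ?_) (hsum.trans (by linarith))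
  rw [← mul_add, ← mul_add, ← mul_add]
  refine mul_le_mul_of_nonneg_left ?_ (Finset.prod_nonneg fun l _ => hw _)
  by_cases hX : τ ≤ ‖m - (∑ l, z (X l)) / L‖
  · rw [if_pos hX]
    set S := ∑ l, (z (X l) - m) with hS
    have hSL : L * τ ≤ ‖S‖ := by
      have : S = -(L * (m - (∑ l, z (X l)) / L)) := by
        have : (L : ℂ) ≠ 0 := by exact_mod_cast hL.ne'
        rw [hS, Finset.sum_sub_distrib]
        simp
        field_simp
        ring
      rw [this, norm_neg, norm_mul, Complex.norm_natCast]
      gcongr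
    have hre : ∑ l, Complex.reLm (z (X l) - m) = S.re := by rw [← map_sum]; rfl
    have him : ∑ l, Complex.imLm (z (X l) - m) = S.im := by rw [← map_sum]; rfl
    have hre' : ∑ l, (-Complex.reLm) (z (X l) - m) = -S.re := by rw [← map_sum]; rfl
    have him' : ∑ l, (-Complex.imLm) (z (X l) - m) = -S.im := by rw [← map_sum]; rfl
    rw [hre, him, hre', him']
    have hn := Complex.norm_le_abs_re_add_abs_im S
    have nn : ∀ (p : Prop), (0 : ℝ) ≤ if p then 1 else 0 := fun p => by split_ifs <;> norm_num
    rcases le_or_gt (L * (τ / 2)) |S.re| with h | h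
    · rcases le_abs.1 h with h | h
      · rw [if_pos h]; linarith [nn (L * (τ / 2) ≤ -S.re), nn (L * (τ / 2) ≤ S.im),
          nn (L * (τ / 2) ≤ -S.im)]
      · rw [if_pos h]; linarith [nn (L * (τ / 2) ≤ S.re), nn (L * (τ / 2) ≤ S.im),
          nn (L * (τ / 2) ≤ -S.im)]
    · have h : L * (τ / 2) ≤ |S.im| := by nlinarith
      rcases le_abs.1 h with h | h
      · rw [if_pos h]; linarith [nn (L * (τ / 2) ≤ -S.re), nn (L * (τ / 2) ≤ S.re),
          nn (L * (τ / 2) ≤ -S.im)]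
      · rw [if_pos h]; linarith [nn (L * (τ / 2) ≤ S.re), nn (L * (τ / 2) ≤ S.im),
          nn (L * (τ / 2) ≤ -S.re)]
  · rw [if_neg hX]
    positivity

open Classical in
/-- A convex combination of functions is approximated, outside a set of small weight,
by an average of few of them. -/
theorem exists_average_approx {V ι : Type*} [Fintype V] [Fintype ι] {w : V → ℝ} {T : V → ι → ℂ}
    {b τ : ℝ} (hb : 0 < b) (hw : ∀ v, 0 ≤ w v) (hw1 : ∑ v, w v = 1)
    (hT : ∀ v x, ‖T v x‖ ≤ b) (hτ : 0 ≤ τ) {L : ℕ} (hL : 0 < L) {ρ : ι → ℝ} (hρ : ∀ x, 0 ≤ ρ x) :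
    ∃ X : Fin L → V,
      ∑ x, ρ x * (if τ ≤ ‖∑ v, (w v : ℂ) * T v x - (∑ l, T (X l) x) / L‖ then 1 else 0)
      ≤ (∑ x, ρ x) * (4 * Real.exp (-(L * τ ^ 2 / (32 * b ^ 2)))) := by
  by_contra! hcon
  set η := 4 * Real.exp (-(L * τ ^ 2 / (32 * b ^ 2))) with hη
  have hW1 : ∑ X : Fin L → V, ∏ l, w (X l) = 1 := by
    rw [← Fintype.sum_pow, hw1, one_pow]
  have hW0 : ∀ X : Fin L → V, 0 ≤ ∏ l, w (X l) := fun X => Finset.prod_nonneg fun l _ => hw _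
  -- A tuple of positive weight keeps the averaged inequality strict.
  obtain ⟨X₀, -, hX₀⟩ : ∃ X₀ ∈ (Finset.univ : Finset (Fin L → V)), 0 < ∏ l, w (X₀ l) := by
    apply Finset.exists_lt_of_sum_lt
    rw [hW1]; simp
  have hlt : ∑ X : Fin L → V, (∏ l, w (X l)) * ((∑ x, ρ x) * η) <
      ∑ X : Fin L → V, (∏ l, w (X l)) *
        ∑ x, ρ x * (if τ ≤ ‖∑ v, (w v : ℂ) * T v x - (∑ l, T (X l) x) / L‖ then 1 else 0) := by
    refine Finset.sum_lt_sum (fun X _ => mul_le_mul_of_nonneg_left (hcon X).le (hW0 X))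
      ⟨X₀, Finset.mem_univ _, mul_lt_mul_of_pos_left (hcon X₀) hX₀⟩
  rw [← Finset.sum_mul, hW1, one_mul] at hlt
  simp_rw [Finset.mul_sum] at hlt
  rw [Finset.sum_comm, Finset.sum_mul] at hlt
  refine absurd hlt (not_lt.2 (Finset.sum_le_sum fun x _ => ?_))
  simp_rw [mul_left_comm _ (ρ x)]
  rw [← Finset.mul_sum]
  exact mul_le_mul_of_nonneg_left
    (hoeffding_complex hb hw hw1 (fun v => hT v x) hτ hL) (hρ x)

/-! ### Independent draws, and the deterministic recovery criterion. -/

open Classical in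
/-- Chernoff's lower tail bound for a sample drawn with replacement. -/
theorem card_sample_few_le {n k : ℕ} (hn : 0 < n) (A : Finset (Fin n)) {q : ℝ}
    (hq : q * n ≤ A.card) :
    ((Finset.univ.filter fun s : Fin k → Fin n =>
        ((Finset.univ.filter fun j => s j ∈ A).card : ℝ) ≤ k * q / 4).card : ℝ)
      ≤ n ^ k * Real.exp (-(k * q / 4)) := by
  have hn' : (0 : ℝ) < n := by exact_mod_cast hn
  have hhalf : Real.exp (-1) ≤ 1 / 2 := by
    rw [Real.exp_neg, one_div]
    exact inv_anti₀ (by norm_num) (by linarith [Real.add_one_le_exp (1 : ℝ)])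
  -- Each draw contributes a factor of mean at most `1 - q/2 ≤ exp(-q/2)` to the transform of the
  -- hit count at `-1`.
  have hbase : ∑ x : Fin n, (if x ∈ A then Real.exp (-1) else 1) ≤ n * Real.exp (-(q / 2)) := by
    have h1 : ∀ x : Fin n, (if x ∈ A then Real.exp (-1) else 1)
        ≤ 1 - (1 / 2 : ℝ) * (if x ∈ A then 1 else 0) := by
      intro x; split_ifs <;> linarith
    calc _ ≤ ∑ x : Fin n, (1 - (1 / 2 : ℝ) * (if x ∈ A then 1 else 0)) :=
          Finset.sum_le_sum fun x _ => h1 x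
      _ = n - 1 / 2 * A.card := by
          rw [Finset.sum_sub_distrib, ← Finset.mul_sum]; simp
      _ ≤ n * (-(q / 2) + 1) := by nlinarith
      _ ≤ _ := mul_le_mul_of_nonneg_left (Real.add_one_le_exp _) hn'.le
  rw [Finset.card_filter]
  push_cast
  calc ∑ s : Fin k → Fin n, (if ((Finset.univ.filter fun j => s j ∈ A).card : ℝ) ≤ k * q / 4
          then (1 : ℝ) else 0)
      ≤ ∑ s : Fin k → Fin n, Real.exp (k * q / 4) *
          ∏ j, (if s j ∈ A then Real.exp (-1) else 1) := by
        refine Finset.sum_le_sum fun s _ => ?_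
        have hp : ∏ j, (if s j ∈ A then Real.exp (-1) else 1)
            = Real.exp (-((Finset.univ.filter fun j => s j ∈ A).card : ℝ)) := by
          rw [Finset.prod_ite]
          simp [← Real.exp_nat_mul]
        rw [hp, ← Real.exp_add]
        split_ifs with h
        · rw [← Real.exp_zero]
          exact Real.exp_le_exp.2 (by linarith)
        · positivity
    _ = Real.exp (k * q / 4) * (∑ x : Fin n, (if x ∈ A then Real.exp (-1) else 1)) ^ k := by
        rw [Fintype.sum_pow, Finset.mul_sum]
    _ ≤ Real.exp (k * q / 4) * (n * Real.exp (-(q / 2))) ^ k := by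
        gcongr
    _ = _ := by
        rw [mul_pow, ← Real.exp_nat_mul, mul_left_comm, ← Real.exp_add]
        congr 2
        ring

theorem RecoversSparse.mono {n r : ℕ} {Ψ : Matrix (Fin n) (Fin n) ℂ} {Ω Ω' : Finset (Fin n)}
    (h : RecoversSparse Ψ r Ω) (hΩ : Ω ⊆ Ω') : RecoversSparse Ψ r Ω' := by
  intro f hf g
  have hfs := (h f hf f).2 rfl
  have feas : ∀ u, IsFeasible Ψ Ω' f u → IsFeasible Ψ Ω f u := fun u hu ω hω => hu ω (hΩ hω)
  constructor
  · intro hg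
    refine (h f hf g).1 ⟨feas g hg.1, fun u hu => ?_⟩
    exact (hg.2 f fun _ _ => rfl).trans (hfs.2 u hu)
  · rintro rfl
    exact ⟨fun _ _ => rfl, fun u hu => hfs.2 u (feas u hu)⟩

/-- Sparse recovery holds if the kernel contains no vector that is small in `ℓ₁` compared
with `ℓ₂`. -/
theorem recoversSparse_of_kernel {n r : ℕ} {Ψ : Matrix (Fin n) (Fin n) ℂ} {Ω : Finset (Fin n)}
    (hker : ∀ h : Fin n → ℂ, (∀ ω ∈ Ω, Ψ.mulVec h ω = 0) → h ≠ 0 →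
      2 * Real.sqrt r * Real.sqrt (∑ t, ‖h t‖ ^ 2) < l1Norm h) :
    RecoversSparse Ψ r Ω := by
  classical
  intro f hf
  have key : ∀ g, IsFeasible Ψ Ω f g → g ≠ f → l1Norm f < l1Norm g := by
    intro g hg hne
    have hk := hker (g - f) (fun ω hω => by
      rw [Matrix.mulVec_sub, Pi.sub_apply, hg ω hω, sub_self]) (sub_ne_zero.2 hne)
    set S := Finset.univ.filter fun t => f t ≠ 0 with hS
    have hSr : (S.card : ℝ) ≤ r := by
      have : S.card ≤ r := by
        have h1 : {i | f i ≠ 0} = (S : Set (Fin n)) := by ext; simp [hS]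
        have h2 := hf
        rw [IsSparse, h1, Set.ncard_coe_finset] at h2
        exact h2
      exact_mod_cast this
    have hcs : ∑ t ∈ S, ‖g t - f t‖ ≤ Real.sqrt r * Real.sqrt (∑ t, ‖g t - f t‖ ^ 2) := by
      rw [← Real.sqrt_mul (by positivity)]
      refine Real.le_sqrt_of_sq_le ?_
      calc (∑ t ∈ S, ‖g t - f t‖) ^ 2 ≤ S.card * ∑ t ∈ S, ‖g t - f t‖ ^ 2 :=
            sq_sum_le_card_mul_sum_sq
        _ ≤ r * ∑ t, ‖g t - f t‖ ^ 2 := by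
            refine mul_le_mul hSr (Finset.sum_le_sum_of_subset_of_nonneg (Finset.subset_univ _)
              fun _ _ _ => by positivity) (Finset.sum_nonneg fun _ _ => by positivity)
              (by positivity)
    -- Off the support of `f` this is an equality; on it, the triangle inequality. Summing, the
    -- kernel vector `g - f` raises the norm unless half its `ℓ₁` mass lies on the support, which
    -- `hcs` forbids.
    have hpt : ∀ t, ‖f t‖ + ‖g t - f t‖ - 2 * (if t ∈ S then ‖g t - f t‖ else 0) ≤ ‖g t‖ := by
      intro t
      by_cases ht : f t = 0
      · simp [hS, ht]
      · have : t ∈ S := by simp [hS, ht]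
        rw [if_pos this]
        have h3 := norm_sub_norm_le (f t) (g t)
        rw [norm_sub_rev] at h3
        linarith
    have hsum := Finset.sum_le_sum fun t (_ : t ∈ Finset.univ) => hpt t
    rw [Finset.sum_sub_distrib, Finset.sum_add_distrib, ← Finset.mul_sum] at hsum
    simp only [Finset.sum_ite_mem, Finset.univ_inter] at hsum
    simp only [l1Norm, Pi.sub_apply] at hk ⊢
    linarith
  intro g
  constructor
  · rintro ⟨h1, h2⟩
    by_contra hne
    exact absurd (h2 f fun _ _ => rfl) (not_le.2 (key g h1 hne))
  · rintro rfl
    refine ⟨fun _ _ => rfl, fun u hu => ?_⟩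
    by_cases hu' : u = g
    · rw [hu']
    · exact (key u hu hu').le

/-! ### From independent draws to uniform subsets. -/

open Classical in
/-- For a monotone property, a uniformly random `k`-subset is at least as good as the range of
`k` independent uniform draws. -/
theorem card_sample_le_probSubset {n k : ℕ} (hn : 0 < n) (hk : k ≤ n)
    {P : Finset (Fin n) → Prop} (hP : ∀ A B, A ⊆ B → P A → P B) :
    ((Finset.univ.filter fun s : Fin k → Fin n => P (Finset.univ.image s)).card : ℝ) / n ^ k
      ≤ probSubset n k P := by
  set N := ((Finset.univ : Finset (Fin n)).powersetCard k).filter P with hN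
  -- Randomising by a permutation `σ`: the image of any fixed `k`-set is a uniform `k`-set, so `c`
  -- is constant on `k`-sets.
  let c : Finset (Fin n) → ℕ := fun T =>
    (Finset.univ.filter fun σ : Equiv.Perm (Fin n) => P (T.map σ.toEmbedding)).card
  have hc : ∀ T T' : Finset (Fin n), T.card = k → T'.card = k → c T = c T' := by
    intro T T' hT hT'
    obtain ⟨τ, hτ⟩ : ∃ τ : Equiv.Perm (Fin n), T.map τ.toEmbedding = T' := by
      let e : {x // x ∈ T} ≃ {x // x ∈ T'} := Finset.equivOfCardEq (hT.trans hT'.symm)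
      refine ⟨e.extendSubtype, ?_⟩
      apply Finset.eq_of_subset_of_card_le
      · intro y hy
        obtain ⟨x, hx, rfl⟩ := Finset.mem_map.1 hy
        exact e.extendSubtype_mem x hx
      · rw [Finset.card_map, hT, hT']
    refine Finset.card_bij' (fun σ _ => τ⁻¹.trans σ) (fun σ _ => τ.trans σ) ?_ ?_ ?_ ?_
    · intro σ hσ
      simp only [Finset.mem_filter, Finset.mem_univ, true_and] at hσ ⊢
      convert hσ using 1
      rw [← hτ, Finset.map_map]
      congr 1
      ext x; simp
    · intro σ hσ
      simp only [Finset.mem_filter, Finset.mem_univ, true_and] at hσ ⊢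
      convert hσ using 1
      rw [← hτ, Finset.map_map]
      congr 1
    · intro σ _; ext x; simp
    · intro σ _; ext x; simp
  have hcount : ∀ T : Finset (Fin n), T.card = k →
      n.choose k * c T = n.factorial * N.card := by
    intro T hT
    have h1 : ∑ T' ∈ (Finset.univ : Finset (Fin n)).powersetCard k, c T' = n.choose k * c T := by
      rw [Finset.sum_congr rfl fun T' hT' => hc T' T (Finset.mem_powersetCard.1 hT').2 hT]
      simp
    rw [← h1]
    simp only [c, Finset.card_filter]
    rw [Finset.sum_comm]
    have h2 : ∀ σ : Equiv.Perm (Fin n),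
        ∑ T' ∈ (Finset.univ : Finset (Fin n)).powersetCard k,
          (if P (T'.map σ.toEmbedding) then 1 else 0) = N.card := by
      intro σ
      rw [hN, Finset.card_filter]
      refine Finset.sum_bij' (fun T _ => T.map σ.toEmbedding)
        (fun T _ => T.map σ.symm.toEmbedding) ?_ ?_ ?_ ?_ ?_
      · intro T hT; simpa [Finset.mem_powersetCard] using hT
      · intro T hT; simpa [Finset.mem_powersetCard] using hT
      · intro T hT; ext x; simp
      · intro T hT; ext x; simp
      · intro T hT; rfl
    simp [h2, Fintype.card_perm]
  have hext : ∀ s : Fin k → Fin n, ∃ T : Finset (Fin n), Finset.univ.image s ⊆ T ∧ T.card = k := by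
    intro s
    obtain ⟨T, h1, -, h2⟩ := Finset.exists_subsuperset_card_eq
      (Finset.subset_univ (Finset.univ.image s)) (n := k)
      (by simpa using Finset.card_image_le (s := Finset.univ) (f := s)) (by simpa using hk)
    exact ⟨T, h1, h2⟩
  choose T hsT hTk using hext
  set G := (Finset.univ.filter fun s : Fin k → Fin n => P (Finset.univ.image s)).card with hG
  -- `σ ∘ s` is again a uniform sample, and its range lies in the image under `σ` of the `k`-set `T
  -- s`; monotonicity compares the two.
  have hmain : n.factorial * G ≤ ∑ s : Fin k → Fin n, c (T s) := by
    have h1 : ∀ σ : Equiv.Perm (Fin n),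
        ∑ s : Fin k → Fin n, (if P ((Finset.univ.image s).map σ.toEmbedding) then 1 else 0)
          = G := by
      intro σ
      rw [hG, Finset.card_filter]
      refine Fintype.sum_equiv (Equiv.arrowCongr (Equiv.refl _) σ) _ _ fun s => ?_
      simp only [Finset.map_eq_image, Finset.image_image]
      rfl
    have h2 : n.factorial * G = ∑ s : Fin k → Fin n, ∑ σ : Equiv.Perm (Fin n),
        (if P ((Finset.univ.image s).map σ.toEmbedding) then 1 else 0) := by
      rw [Finset.sum_comm]
      simp [h1, Fintype.card_perm]
    rw [h2]
    refine Finset.sum_le_sum fun s _ => ?_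
    simp only [c, Finset.card_filter]
    refine Finset.sum_le_sum fun σ _ => ?_
    by_cases h : P ((Finset.univ.image s).map σ.toEmbedding)
    · rw [if_pos h, if_pos (hP _ _ (Finset.map_subset_map.2 (hsT s)) h)]
    · rw [if_neg h]; exact Nat.zero_le _
  have hfin : n.factorial * (n.choose k * G) ≤ n.factorial * (n ^ k * N.card) := by
    calc n.factorial * (n.choose k * G) = n.choose k * (n.factorial * G) := by ring
      _ ≤ n.choose k * ∑ s : Fin k → Fin n, c (T s) := Nat.mul_le_mul_left _ hmain
      _ = ∑ s : Fin k → Fin n, n.factorial * N.card := by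
          rw [Finset.mul_sum]
          exact Finset.sum_congr rfl fun s _ => hcount _ (hTk s)
      _ = n.factorial * (n ^ k * N.card) := by simp; ring
  have hfin' := Nat.le_of_mul_le_mul_left hfin n.factorial_pos
  have hch : (0 : ℝ) < n.choose k := by exact_mod_cast Nat.choose_pos hk
  have hnk : (0 : ℝ) < (n : ℝ) ^ k := by positivity
  rw [probSubset, div_le_div_iff₀ hnk hch]
  have : ((n.choose k * G : ℕ) : ℝ) ≤ ((n ^ k * N.card : ℕ) : ℝ) := by exact_mod_cast hfin'
  push_cast at this
  rw [hG, hN] at this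
  linarith

/-! ### Dyadic levels. -/

open Classical in
/-- A bounded function with mean square one is large, relative to some dyadic level,
on a set of non-negligible measure. -/
theorem exists_level {n I : ℕ} (hn : 0 < n) {F : Fin n → ℂ} (hF : ∀ ω, ‖F ω‖ < 2 ^ I)
    (h2 : ∑ ω, ‖F ω‖ ^ 2 = n) :
    ∃ i ≤ I, 1 / (2 * 4 ^ i * (I + 1)) * (n : ℝ) ≤
      ((Finset.univ.filter fun ω => (2 : ℝ) ^ i / 2 ≤ ‖F ω‖).card : ℝ) := by
  by_contra! hcon
  have hn' : (0 : ℝ) < n := by exact_mod_cast hn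
  -- The level `m` with `2^m ≤ 2‖F ω‖ < 2^(m+1)` alone pays for `‖F ω‖²`. Were all levels thin, the
  -- total would be at most `n/4 + n/2 < n`.
  have hpt : ∀ ω, ‖F ω‖ ^ 2 ≤ 1 / 4 + ∑ i ∈ Finset.range (I + 1),
      (4 : ℝ) ^ i * (if (2 : ℝ) ^ i / 2 ≤ ‖F ω‖ then 1 else 0) := by
    intro ω
    have hnn : ∀ i ∈ Finset.range (I + 1),
        (0 : ℝ) ≤ 4 ^ i * (if (2 : ℝ) ^ i / 2 ≤ ‖F ω‖ then 1 else 0) := fun i _ => by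
      split_ifs <;> positivity
    rcases lt_or_ge ‖F ω‖ (1 / 2) with h | h
    · have := Finset.sum_nonneg hnn
      nlinarith [norm_nonneg (F ω)]
    · obtain ⟨m, hm1, hm2⟩ := exists_nat_pow_near (x := 2 * ‖F ω‖) (y := 2) (by linarith)
        (by norm_num)
      have hmI : m < I + 1 := by
        have : (2 : ℝ) ^ m < 2 ^ (I + 1) := by
          rw [pow_succ]; linarith [hF ω]
        exact (pow_lt_pow_iff_right₀ (by norm_num)).1 this
      have h1 := Finset.single_le_sum hnn (Finset.mem_range.2 hmI)
      rw [if_pos (by linarith)] at h1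
      have h3 : ‖F ω‖ ≤ 2 ^ m := by rw [pow_succ] at hm2; linarith
      have h4 : ‖F ω‖ ^ 2 ≤ 4 ^ m := by
        calc ‖F ω‖ ^ 2 ≤ (2 ^ m) ^ 2 := by gcongr
          _ = 4 ^ m := by rw [← pow_mul, mul_comm, pow_mul]; norm_num
      linarith
  have hsum := Finset.sum_le_sum fun ω (_ : ω ∈ Finset.univ) => hpt ω
  rw [h2, Finset.sum_add_distrib, Finset.sum_comm] at hsum
  have hlev : ∀ i ∈ Finset.range (I + 1),
      ∑ ω, (4 : ℝ) ^ i * (if (2 : ℝ) ^ i / 2 ≤ ‖F ω‖ then 1 else 0) ≤ n / (2 * (I + 1)) := by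
    intro i hi
    have h := hcon i (Nat.lt_succ_iff.1 (Finset.mem_range.1 hi))
    rw [← Finset.mul_sum, Finset.sum_boole]
    calc (4 : ℝ) ^ i * _ ≤ 4 ^ i * (1 / (2 * 4 ^ i * (I + 1)) * n) := by gcongr
      _ = _ := by field_simp
  have h5 := Finset.sum_le_sum hlev
  have h6 : ∑ i ∈ Finset.range (I + 1), (n : ℝ) / (2 * (I + 1)) = n / 2 := by
    simp; field_simp
  rw [h6] at h5
  simp only [Finset.sum_const, Finset.card_univ, Fintype.card_fin, nsmul_eq_mul] at hsum
  linarith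

/-! ### Cross-polytope atoms. -/

/-- The four complex directions `1, -1, i, -i`. -/
def phase : Fin 4 → ℂ := ![1, -1, Complex.I, -Complex.I]

/-- The value of the linear functional with coefficients `B` at an extreme point of the
ball of radius `M` for the norm `∑ (|Re| + |Im|)`, or at the origin. -/
def crossAtom {n : ℕ} (M : ℝ) (B : Fin n → ℂ) : Option (Fin n × Fin 4) → ℂ
  | none => 0
  | some p => M * (B p.1 * phase p.2)

theorem norm_phase (c : Fin 4) : ‖phase c‖ = 1 := by
  fin_cases c <;> simp [phase]

theorem norm_crossAtom_le {n : ℕ} {M κ : ℝ} (hM : 0 ≤ M) (hκ : 0 ≤ κ) {B : Fin n → ℂ}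
    (hB : ∀ t, ‖B t‖ ≤ κ) (v : Option (Fin n × Fin 4)) : ‖crossAtom M B v‖ ≤ M * κ := by
  rcases v with _ | p
  · simpa [crossAtom] using mul_nonneg hM hκ
  · simp only [crossAtom, norm_mul, norm_phase, mul_one, Complex.norm_real, Real.norm_of_nonneg hM]
    exact mul_le_mul_of_nonneg_left (hB _) hM

/-- Positive and negative parts of `Re z` and `Im z` serve as weights. Their total is `|Re z| + |Im
z|`, the source of the factor 2 in the radius of the cross-polytope. -/
theorem exists_phase_weights (z : ℂ) : ∃ q : Fin 4 → ℝ, (∀ c, 0 ≤ q c) ∧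
    ∑ c, q c ≤ 2 * ‖z‖ ∧ ∑ c, (q c : ℂ) * phase c = z := by
  refine ⟨![max z.re 0, max (-z.re) 0, max z.im 0, max (-z.im) 0], ?_, ?_, ?_⟩
  · intro c; fin_cases c <;> simp
  · have h1 := max_zero_add_max_neg_zero_eq_abs_self z.re
    have h2 := max_zero_add_max_neg_zero_eq_abs_self z.im
    simp only [Fin.sum_univ_four, Matrix.cons_val]
    linarith [Complex.abs_re_le_norm z, Complex.abs_im_le_norm z]
  · have h1 := max_zero_sub_max_neg_zero_eq_self z.re
    have h2 := max_zero_sub_max_neg_zero_eq_self z.im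
    apply Complex.ext
    · simp [Fin.sum_univ_four, phase]; linarith
    · simp [Fin.sum_univ_four, phase]; linarith

/-- Every vector in a suitable `ℓ₁` ball is a convex combination of the cross-polytope atoms. -/
theorem exists_crossAtom_weights {n : ℕ} {M : ℝ} (hM : 0 < M) (h : Fin n → ℂ)
    (hh : 2 * l1Norm h ≤ M) :
    ∃ w : Option (Fin n × Fin 4) → ℝ, (∀ v, 0 ≤ w v) ∧ ∑ v, w v = 1 ∧
      ∀ B : Fin n → ℂ, ∑ v, (w v : ℂ) * crossAtom M B v = ∑ t, B t * h t := by
  choose q hq0 hq1 hq2 using fun t => exists_phase_weights (h t)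
  -- The atom at the origin takes up the slack, so that the weights sum to 1.
  refine ⟨fun v => v.elim (1 - ∑ t, ∑ c, q t c / M) fun p => q p.1 p.2 / M, ?_, ?_, ?_⟩
  · rintro (_ | p)
    · have : ∑ t, ∑ c, q t c / M ≤ 1 := by
        simp_rw [← Finset.sum_div]
        rw [div_le_one hM]
        refine le_trans (Finset.sum_le_sum fun t _ => hq1 t) ?_
        rwa [← Finset.mul_sum]
      simpa using this
    · exact div_nonneg (hq0 _ _) hM.le
  · rw [Fintype.sum_option, Fintype.sum_prod_type]
    simp
  · intro B
    rw [Fintype.sum_option, Fintype.sum_prod_type]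
    have hM' : (M : ℂ) ≠ 0 := by exact_mod_cast hM.ne'
    simp only [crossAtom, mul_zero, zero_add, Option.elim]
    refine Finset.sum_congr rfl fun t _ => ?_
    rw [← hq2 t, Finset.mul_sum]
    refine Finset.sum_congr rfl fun c _ => ?_
    push_cast
    field_simp

/-! ### Transfer from population to sample. -/

open Classical in
/-- If every average of `L` atoms that is often large on the population is also often large on
the sample, then a convex combination of atoms that is often large does not vanish on the
sample. -/
theorem exists_sample_ne_zero {V : Type*} [Fintype V] {n k L : ℕ} (hn : 0 < n) (hk : 0 < k)
    (hL : 0 < L) {w : V → ℝ} {T : V → Fin n → ℂ} {b τ q : ℝ} (hb : 0 < b) (hτ : 0 ≤ τ)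
    (hw : ∀ v, 0 ≤ w v) (hw1 : ∑ v, w v = 1) (hT : ∀ v x, ‖T v x‖ ≤ b)
    (hη : 4 * Real.exp (-(L * τ ^ 2 / (32 * b ^ 2))) ≤ q / 8)
    (hlarge : 2 * q * n ≤
      ((Finset.univ.filter fun x => 2 * τ ≤ ‖∑ v, (w v : ℂ) * T v x‖).card : ℝ))
    {s : Fin k → Fin n}
    (hs : ∀ X : Fin L → V,
      q * n ≤ ((Finset.univ.filter fun x => τ ≤ ‖(∑ l, T (X l) x) / L‖).card : ℝ) →
      k * q / 4 < ((Finset.univ.filter fun j => τ ≤ ‖(∑ l, T (X l) (s j)) / L‖).card : ℝ)) :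
    ∃ j, ∑ v, (w v : ℂ) * T v (s j) ≠ 0 := by
  have hn' : (0 : ℝ) < n := by exact_mod_cast hn
  have hk' : (0 : ℝ) < k := by exact_mod_cast hk
  set F : Fin n → ℂ := fun x => ∑ v, (w v : ℂ) * T v x with hFdef
  -- A single tuple `X` must serve population and sample at once, so the approximation is run on
  -- their disjoint union, each half with mass 1. The exceptional mass is then at most `2 · q/8 =
  -- q/4`.
  obtain ⟨X, hX⟩ := exists_average_approx (ι := Fin n ⊕ Fin k) (w := w)
    (T := fun v x => T v (x.elim id s)) hb hw hw1 (fun v x => hT v _) hτ hL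
    (ρ := fun x => x.elim (fun _ => 1 / (n : ℝ)) (fun _ => 1 / (k : ℝ)))
    (by rintro (x | x) <;> simp)
  set G : Fin n → ℂ := fun x => (∑ l, T (X l) x) / L with hG
  set bad := Finset.univ.filter fun x => τ ≤ ‖F x - G x‖ with hbad
  set bads := Finset.univ.filter fun j => τ ≤ ‖F (s j) - G (s j)‖ with hbads
  rw [Fintype.sum_sum_type, Fintype.sum_sum_type] at hX
  change (∑ x, 1 / (n : ℝ) * (if τ ≤ ‖F x - G x‖ then 1 else 0)) +
    (∑ j, 1 / (k : ℝ) * (if τ ≤ ‖F (s j) - G (s j)‖ then 1 else 0)) ≤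
    ((∑ _x : Fin n, 1 / (n : ℝ)) + ∑ _j : Fin k, 1 / (k : ℝ)) * _ at hX
  rw [← Finset.mul_sum, ← Finset.mul_sum, Finset.sum_boole, Finset.sum_boole] at hX
  change 1 / (n : ℝ) * (bad.card : ℝ) + 1 / (k : ℝ) * (bads.card : ℝ) ≤ _ at hX
  have htot : (∑ _x : Fin n, 1 / (n : ℝ)) + ∑ _j : Fin k, 1 / (k : ℝ) = 2 := by
    simp [hn'.ne', hk'.ne']; norm_num
  rw [htot] at hX
  have hb1 : (bad.card : ℝ) ≤ q / 4 * n := by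
    have h1 : 1 / (n : ℝ) * bad.card ≤ q / 4 := by
      have : (0 : ℝ) ≤ 1 / (k : ℝ) * bads.card := by positivity
      linarith
    rw [one_div, inv_mul_le_iff₀ hn'] at h1
    linarith
  have hb2 : (bads.card : ℝ) ≤ k * q / 4 := by
    have h1 : 1 / (k : ℝ) * bads.card ≤ q / 4 := by
      have : (0 : ℝ) ≤ 1 / (n : ℝ) * bad.card := by positivity
      linarith
    rw [one_div, inv_mul_le_iff₀ hk'] at h1
    linarith
  have hq : 0 ≤ q := by
    have := Real.exp_pos (-(L * τ ^ 2 / (32 * b ^ 2)))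
    linarith
  have hGlarge : q * n ≤ ((Finset.univ.filter fun x => τ ≤ ‖G x‖).card : ℝ) := by
    have hsub : (Finset.univ.filter fun x => 2 * τ ≤ ‖F x‖) ⊆
        (Finset.univ.filter fun x => τ ≤ ‖G x‖) ∪ bad := by
      intro x hx
      simp only [hbad, Finset.mem_union, Finset.mem_filter, Finset.mem_univ, true_and] at hx ⊢
      by_contra! hcon
      have := norm_le_norm_sub_add (F x) (G x)
      linarith [hcon.1, hcon.2]
    have hc : ((Finset.univ.filter fun x => 2 * τ ≤ ‖F x‖).card : ℝ) ≤
        (Finset.univ.filter fun x => τ ≤ ‖G x‖).card + bad.card := by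
      exact_mod_cast (Finset.card_le_card hsub).trans (Finset.card_union_le _ _)
    nlinarith [mul_nonneg hq hn'.le]
  -- More sample points have `G` large than are exceptional, so some point is large and not
  -- exceptional. `X` depends on `s`, which is why `hs` covers all tuples.
  have hlt := hb2.trans_lt (hs X hGlarge)
  obtain ⟨j, hj1, hj2⟩ := Finset.exists_mem_notMem_of_card_lt_card (Nat.cast_lt.1 hlt)
  refine ⟨j, fun h0 => hj2 ?_⟩
  have h0' : F (s j) = 0 := h0
  simp only [hbads, Finset.mem_filter, Finset.mem_univ, true_and] at hj1 ⊢
  rw [h0', zero_sub, norm_neg]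
  exact hj1

open Classical in
/-- With high probability, all averages of `L` atoms that are often large on the population are
also often large on the sample. -/
theorem card_not_sample_large_le {V : Type*} [Fintype V] {n k L : ℕ} (hn : 0 < n)
    (T : V → Fin n → ℂ) (τ q : ℝ) :
    ((Finset.univ.filter fun s : Fin k → Fin n => ¬ ∀ X : Fin L → V,
      q * n ≤ ((Finset.univ.filter fun x => τ ≤ ‖(∑ l, T (X l) x) / L‖).card : ℝ) →
      k * q / 4 < ((Finset.univ.filter fun j => τ ≤ ‖(∑ l, T (X l) (s j)) / L‖).card : ℝ)).card : ℝ)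
      ≤ (Fintype.card V : ℝ) ^ L * (n ^ k * Real.exp (-(k * q / 4))) := by
  let A : (Fin L → V) → Finset (Fin n) := fun X =>
    Finset.univ.filter fun x => τ ≤ ‖(∑ l, T (X l) x) / L‖
  let Bd : (Fin L → V) → Finset (Fin k → Fin n) := fun X =>
    if q * n ≤ (A X).card then Finset.univ.filter fun s : Fin k → Fin n =>
        ((Finset.univ.filter fun j => s j ∈ A X).card : ℝ) ≤ k * q / 4 else ∅
  have hBd : ∀ X, ((Bd X).card : ℝ) ≤ n ^ k * Real.exp (-(k * q / 4)) := by
    intro X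
    by_cases h : q * n ≤ (A X).card
    · simp only [Bd, if_pos h]
      exact card_sample_few_le hn _ h
    · simp only [Bd, if_neg h, Finset.card_empty, Nat.cast_zero]
      positivity
  have hsub : (Finset.univ.filter fun s : Fin k → Fin n => ¬ ∀ X : Fin L → V,
      q * n ≤ ((Finset.univ.filter fun x => τ ≤ ‖(∑ l, T (X l) x) / L‖).card : ℝ) →
      k * q / 4 < ((Finset.univ.filter fun j => τ ≤ ‖(∑ l, T (X l) (s j)) / L‖).card : ℝ))
      ⊆ Finset.univ.biUnion Bd := by
    intro s hs
    simp only [Finset.mem_filter, Finset.mem_univ, true_and] at hs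
    push Not at hs
    obtain ⟨X, h1, h2⟩ := hs
    refine Finset.mem_biUnion.2 ⟨X, Finset.mem_univ _, ?_⟩
    have h1' : q * n ≤ (A X).card := h1
    simp only [Bd, if_pos h1', Finset.mem_filter, Finset.mem_univ, true_and]
    simpa [A] using h2
  calc _ ≤ ((Finset.univ.biUnion Bd).card : ℝ) := by exact_mod_cast Finset.card_le_card hsub
    _ ≤ ∑ X, ((Bd X).card : ℝ) := by exact_mod_cast Finset.card_biUnion_le
    _ ≤ ∑ _X : Fin L → V, (n : ℝ) ^ k * Real.exp (-(k * q / 4)) :=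
        Finset.sum_le_sum fun X _ => hBd X
    _ = _ := by simp

/-! ### Parseval's identity and the choice of constants. -/

theorem sum_norm_sq_mulVec {n : ℕ} {Ψ : Matrix (Fin n) (Fin n) ℂ}
    (hΨ : Ψ ∈ Matrix.unitaryGroup (Fin n) ℂ) (h : Fin n → ℂ) :
    ∑ ω, ‖Ψ.mulVec h ω‖ ^ 2 = ∑ t, ‖h t‖ ^ 2 := by
  have hs : ∀ v : Fin n → ℂ, ((∑ t, ‖v t‖ ^ 2 : ℝ) : ℂ) = star v ⬝ᵥ v := by
    intro v
    simp [dotProduct, Complex.conj_mul']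
  have hu : Ψ.conjTranspose * Ψ = 1 := Matrix.mem_unitaryGroup_iff'.1 hΨ
  have : ((∑ ω, ‖Ψ.mulVec h ω‖ ^ 2 : ℝ) : ℂ) = ((∑ t, ‖h t‖ ^ 2 : ℝ) : ℂ) := by
    rw [hs, hs, Matrix.star_mulVec, ← Matrix.dotProduct_mulVec, Matrix.mulVec_mulVec, hu,
      Matrix.one_mulVec]
  exact_mod_cast this

/-- Fixes the length `L` of the averages at level `i`. Here `8192 = 16 · 32 · 16` makes the exponent
at least `5 + 3I`, and `e^5 ≥ 128`, `e^(3I) ≥ 8^I ≥ 4^i (I+1)`. -/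
theorem four_mul_exp_le {r K : ℝ} (hr : 0 < r) (hK : 0 < K) {i I L : ℕ} (hi : i ≤ I)
    (hL : 8192 * (r * K ^ 2) * (5 + 3 * I) / 4 ^ i ≤ L) :
    4 * Real.exp (-(L * ((2 : ℝ) ^ i / 4) ^ 2 / (32 * (4 * Real.sqrt r * K) ^ 2)))
      ≤ 1 / (4 * 4 ^ i * (I + 1)) / 8 := by
  have h4 : ((2 : ℝ) ^ i) ^ 2 = 4 ^ i := by rw [← pow_mul, mul_comm, pow_mul]; norm_num
  have hexp : (5 + 3 * I : ℝ) ≤ L * ((2 : ℝ) ^ i / 4) ^ 2 / (32 * (4 * Real.sqrt r * K) ^ 2) := by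
    rw [div_pow, h4, mul_pow, mul_pow, Real.sq_sqrt hr.le]
    rw [div_le_iff₀ (by positivity)] at hL
    rw [le_div_iff₀ (by positivity)]
    linarith
  have he : (2.7 : ℝ) ≤ Real.exp 1 := by linarith [Real.exp_one_gt_d9]
  have h5 : (128 : ℝ) * (4 ^ i * (I + 1)) ≤ Real.exp (5 + 3 * I) := by
    have e1 : Real.exp (5 + 3 * I) = Real.exp 1 ^ 5 * (Real.exp 1 ^ 3) ^ I := by
      rw [← pow_mul, ← pow_add, ← Real.exp_nat_mul]
      push_cast
      ring_nf
    have e2 : (128 : ℝ) ≤ Real.exp 1 ^ 5 :=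
      le_trans (by norm_num) (pow_le_pow_left₀ (by norm_num) he 5)
    have e3 : (8 : ℝ) ≤ Real.exp 1 ^ 3 :=
      le_trans (by norm_num) (pow_le_pow_left₀ (by norm_num) he 3)
    have e4 : (I + 1 : ℝ) ≤ 2 ^ I := by exact_mod_cast Nat.lt_two_pow_self (n := I)
    have e5 : (4 : ℝ) ^ i ≤ 4 ^ I := pow_le_pow_right₀ (by norm_num) hi
    have e6 : (4 : ℝ) ^ I * 2 ^ I = 8 ^ I := by rw [← mul_pow]; norm_num
    rw [e1]
    calc (128 : ℝ) * (4 ^ i * (I + 1)) ≤ 128 * (4 ^ I * 2 ^ I) := by gcongr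
      _ = 128 * 8 ^ I := by rw [e6]
      _ ≤ _ := by gcongr
  calc _ ≤ 4 * Real.exp (-(5 + 3 * I)) := by gcongr
    _ = 4 / Real.exp (5 + 3 * I) := by rw [Real.exp_neg]; rfl
    _ ≤ 4 / (128 * (4 ^ i * (I + 1))) := by gcongr
    _ = _ := by field_simp; norm_num

/-- The union bound at one level, with `a = r K² / 4^i`. From `4n+1 ≤ n^5` one needs `(5L+2) log n`
in the exponent; `1 ≤ 16a` absorbs the rounding of `L` and the 2, and `3280000 = 16 · 205000`. -/
theorem pow_mul_exp_le {n k i I L : ℕ} {a : ℝ} (hn : 2 ≤ n) (ha : 1 ≤ 16 * a)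
    (hL : (L : ℝ) ≤ 8192 * a * (5 + 3 * I) + 1)
    (hk : 3280000 * (a * 4 ^ i) * (I + 1) ^ 2 * Real.log n ≤ k) :
    (4 * n + 1 : ℝ) ^ L * Real.exp (-(k * (1 / (4 * 4 ^ i * (I + 1))) / 4)) ≤ 1 / n ^ 2 := by
  have hn' : (2 : ℝ) ≤ n := by exact_mod_cast hn
  have hn0 : (0 : ℝ) < n := by linarith
  have hlog : 0 ≤ Real.log n := Real.log_nonneg (by linarith)
  have ha0 : 0 < a := by linarith
  have hI0 : (0 : ℝ) ≤ I := Nat.cast_nonneg I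
  have h1 : (4 * n + 1 : ℝ) ≤ n ^ 5 := by
    have : (2 : ℝ) ^ 4 ≤ n ^ 4 := pow_le_pow_left₀ (by norm_num) hn' 4
    nlinarith
  have h2 : (5 * L + 2 : ℝ) ≤ 205000 * (a * (I + 1)) := by nlinarith [mul_nonneg ha0.le hI0]
  have h3 : 205000 * (a * (I + 1)) * Real.log n ≤ k * (1 / (4 * 4 ^ i * (I + 1))) / 4 := by
    rw [mul_one_div, div_div, le_div_iff₀ (by positivity)]
    linarith
  have h4 : ((n : ℝ) ^ 5) ^ L * n ^ 2 ≤ Real.exp (k * (1 / (4 * 4 ^ i * (I + 1))) / 4) := by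
    have hpow : (n : ℝ) ^ (5 * L + 2) = Real.exp ((5 * L + 2 : ℕ) * Real.log n) := by
      rw [Real.exp_nat_mul, Real.exp_log hn0]
    rw [← pow_mul, ← pow_add, hpow]
    refine Real.exp_le_exp.2 ?_
    push_cast
    exact (mul_le_mul_of_nonneg_right h2 hlog).trans h3
  rw [Real.exp_neg, ← div_eq_mul_inv, div_le_div_iff₀ (Real.exp_pos _) (by positivity), one_mul]
  refine le_trans ?_ h4
  gcongr

/-! ### The main probability estimate. -/

/-- Quantitative sparse recovery from a random sample of the rows of a bounded unitary matrix,
where `I` is the number of relevant dyadic levels. -/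
theorem le_probSubset_recoversSparse {n r k I : ℕ} {K : ℝ} (hn : 2 ≤ n) (hr : 1 ≤ r) (hK : 1 ≤ K)
    (hI1 : 2 * Real.sqrt r * K < 2 ^ I) (hI2 : (2 : ℝ) ^ I ≤ 4 * Real.sqrt r * K) (hkn : k ≤ n)
    (hk : 3280000 * (r * K ^ 2) * (I + 1) ^ 2 * Real.log n ≤ k)
    {Ψ : Matrix (Fin n) (Fin n) ℂ} (hΨ : Ψ ∈ Matrix.unitaryGroup (Fin n) ℂ)
    (hΨK : ∀ i j, ‖Ψ i j‖ ≤ K / Real.sqrt n) :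
    1 - 1 / (n : ℝ) ≤ probSubset n k (RecoversSparse Ψ r) := by
  classical
  have hn0 : 0 < n := by omega
  have hn2 : (2 : ℝ) ≤ n := by exact_mod_cast hn
  have hn' : (0 : ℝ) < n := by linarith
  have hr' : (1 : ℝ) ≤ r := by exact_mod_cast hr
  have hr0 : (0 : ℝ) < r := by linarith
  have hK0 : 0 < K := by linarith
  have hsr : 0 < Real.sqrt r := Real.sqrt_pos.2 hr0
  have hsn : 0 < Real.sqrt n := Real.sqrt_pos.2 hn'
  have hI0 : (0 : ℝ) ≤ I := Nat.cast_nonneg I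
  have hlog : (1 / 2 : ℝ) ≤ Real.log n := by
    have := Real.log_le_log (by norm_num) hn2
    linarith [Real.log_two_gt_d9]
  have hIk : (I + 1 : ℝ) ≤ k := by
    refine le_trans ?_ hk
    have h1 : (1 : ℝ) ≤ r * K ^ 2 := by nlinarith
    have h2 : (I + 1 : ℝ) ≤ (I + 1) ^ 2 := by nlinarith
    calc (I + 1 : ℝ) ≤ 2 * 1 * (I + 1) ^ 2 * (1 / 2) := by linarith
      _ ≤ 3280000 * (r * K ^ 2) * (I + 1) ^ 2 * Real.log n := by
        gcongr
        norm_num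
  have hk0 : 0 < k := by
    have : (0 : ℝ) < k := by linarith
    exact_mod_cast this
  have hIn : (I + 1 : ℝ) ≤ n := hIk.trans (by exact_mod_cast hkn)
  set L : ℕ → ℕ := fun i => ⌈8192 * (r * K ^ 2) * (5 + 3 * I) / 4 ^ i⌉₊ with hLdef
  have hLpos : ∀ i, 0 < L i := fun i => Nat.ceil_pos.2 (by positivity)
  set T : Option (Fin n × Fin 4) → Fin n → ℂ :=
    fun v ω => crossAtom (4 * Real.sqrt r) (fun t => (Real.sqrt n : ℂ) * Ψ ω t) v with hTdef
  have hA : ∀ ω t, ‖(Real.sqrt n : ℂ) * Ψ ω t‖ ≤ K := by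
    intro ω t
    rw [norm_mul, Complex.norm_real, Real.norm_of_nonneg hsn.le]
    calc Real.sqrt n * ‖Ψ ω t‖ ≤ Real.sqrt n * (K / Real.sqrt n) := by gcongr; exact hΨK _ _
      _ = K := by field_simp
  have hT : ∀ v x, ‖T v x‖ ≤ 4 * Real.sqrt r * K := fun v x =>
    norm_crossAtom_le (by positivity) hK0.le (hA x) v
  -- A condition on the finite family of averages alone, with no mention of `h`; it therefore yields
  -- recovery of all signals at once.
  let good : ℕ → (Fin k → Fin n) → Prop := fun i s => ∀ X : Fin (L i) → Option (Fin n × Fin 4),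
    1 / (4 * 4 ^ i * (I + 1)) * (n : ℝ) ≤
      ((Finset.univ.filter fun x => (2 : ℝ) ^ i / 4 ≤ ‖(∑ l, T (X l) x) / L i‖).card : ℝ) →
    k * (1 / (4 * 4 ^ i * (I + 1))) / 4 <
      ((Finset.univ.filter fun j => (2 : ℝ) ^ i / 4 ≤ ‖(∑ l, T (X l) (s j)) / L i‖).card : ℝ)
  have hgood : ∀ s : Fin k → Fin n, (∀ i ≤ I, good i s) →
      RecoversSparse Ψ r (Finset.univ.image s) := by
    intro s hs
    refine recoversSparse_of_kernel fun h hker hne => ?_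
    by_contra! hcon
    set N := Real.sqrt (∑ t, ‖h t‖ ^ 2) with hN
    have hNpos : 0 < N := by
      obtain ⟨t, ht⟩ := Function.ne_iff.1 hne
      refine Real.sqrt_pos.2 (Finset.sum_pos' (fun _ _ => by positivity) ⟨t, Finset.mem_univ _, ?_⟩)
      have : 0 < ‖h t‖ := norm_pos_iff.2 ht
      positivity
    have hN2 : N ^ 2 = ∑ t, ‖h t‖ ^ 2 :=
      Real.sq_sqrt (Finset.sum_nonneg fun _ _ => by positivity)
    set u : Fin n → ℂ := fun t => h t / N with hu
    have hun : ∀ t, ‖u t‖ = ‖h t‖ / N := fun t => by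
      rw [hu, norm_div, Complex.norm_real, Real.norm_of_nonneg hNpos.le]
    have hu1 : l1Norm u ≤ 2 * Real.sqrt r := by
      simp only [l1Norm, hun] at hcon ⊢
      rw [← Finset.sum_div, div_le_iff₀ hNpos]
      exact hcon
    have hu2 : ∑ t, ‖u t‖ ^ 2 = 1 := by
      simp only [hun, div_pow]
      rw [← Finset.sum_div, ← hN2, div_self (by positivity)]
    have hmul : ∀ ω, ∑ t, (Real.sqrt n : ℂ) * Ψ ω t * u t = Real.sqrt n * Ψ.mulVec u ω := by
      intro ω
      rw [Matrix.mulVec, dotProduct, Finset.mul_sum]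
      exact Finset.sum_congr rfl fun t _ => by ring
    obtain ⟨w, hw, hw1, hwB⟩ := exists_crossAtom_weights (M := 4 * Real.sqrt r) (by positivity) u
      (by linarith)
    have hF : ∀ ω, ∑ v, (w v : ℂ) * T v ω = Real.sqrt n * Ψ.mulVec u ω := fun ω =>
      (hwB _).trans (hmul ω)
    obtain ⟨i, hiI, hi⟩ := exists_level (I := I) hn0
      (F := fun ω => ∑ v, (w v : ℂ) * T v ω) (by
        intro ω
        refine lt_of_le_of_lt ?_ hI1
        rw [hwB]
        calc _ ≤ ∑ t, ‖(Real.sqrt n : ℂ) * Ψ ω t * u t‖ := norm_sum_le _ _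
          _ ≤ ∑ t, K * ‖u t‖ := Finset.sum_le_sum fun t _ => by
              rw [norm_mul]
              exact mul_le_mul_of_nonneg_right (hA ω t) (norm_nonneg _)
          _ = K * l1Norm u := by rw [l1Norm, Finset.mul_sum]
          _ ≤ K * (2 * Real.sqrt r) := by gcongr
          _ = _ := by ring) (by
        simp only [hF, norm_mul, mul_pow, Complex.norm_real, Real.norm_of_nonneg hsn.le,
          Real.sq_sqrt hn'.le]
        rw [← Finset.mul_sum, sum_norm_sq_mulVec hΨ, hu2, mul_one])
    obtain ⟨j, hj⟩ := exists_sample_ne_zero hn0 hk0 (hLpos i) (b := 4 * Real.sqrt r * K)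
      (τ := (2 : ℝ) ^ i / 4) (q := 1 / (4 * 4 ^ i * (I + 1))) (by positivity) (by positivity)
      hw hw1 hT (four_mul_exp_le hr0 hK0 hiI (Nat.le_ceil _)) (by
        have e1 : (2 : ℝ) * (1 / (4 * 4 ^ i * (I + 1))) = 1 / (2 * 4 ^ i * (I + 1)) := by
          field_simp; norm_num
        have e2 : (2 : ℝ) * (2 ^ i / 4) = 2 ^ i / 2 := by ring
        rw [e1, e2]
        exact hi) (hs i hiI)
    refine hj ?_
    have hus : u = (N : ℂ)⁻¹ • h := by
      ext t; simp [hu, div_eq_inv_mul]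
    rw [hF, hus, Matrix.mulVec_smul, Pi.smul_apply,
      hker _ (Finset.mem_image_of_mem _ (Finset.mem_univ j)), smul_zero, mul_zero]
  have hbad : ∀ i ∈ Finset.range (I + 1),
      ((Finset.univ.filter fun s => ¬ good i s).card : ℝ) ≤ n ^ k * (1 / n ^ 2) := by
    intro i hi
    have hi' : i ≤ I := Nat.lt_succ_iff.1 (Finset.mem_range.1 hi)
    have h4 : ((2 : ℝ) ^ I) ^ 2 = 4 ^ I := by rw [← pow_mul, mul_comm, pow_mul]; norm_num
    -- The upper bound on `2^I` enters here: even at the top level, `r K² / 4^i` stays above `1/16`.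
    have h4i : (4 : ℝ) ^ i ≤ 16 * (r * K ^ 2) := by
      calc (4 : ℝ) ^ i ≤ 4 ^ I := pow_le_pow_right₀ (by norm_num) hi'
        _ = (2 ^ I) ^ 2 := h4.symm
        _ ≤ (4 * Real.sqrt r * K) ^ 2 := by gcongr
        _ = _ := by rw [mul_pow, mul_pow, Real.sq_sqrt hr0.le]; ring
    have h1 := card_not_sample_large_le (k := k) (L := L i) hn0 T ((2 : ℝ) ^ i / 4)
      (1 / (4 * 4 ^ i * (I + 1)))
    have h2 := pow_mul_exp_le (n := n) (k := k) (i := i) (I := I) (L := L i)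
      (a := r * K ^ 2 / 4 ^ i) hn (by rw [← mul_div_assoc, le_div_iff₀ (by positivity)]; linarith)
      (by
        refine (Nat.ceil_lt_add_one (by positivity)).le.trans (le_of_eq ?_)
        ring) (by rwa [div_mul_cancel₀ _ (by positivity)])
    refine h1.trans ?_
    have hcard : (Fintype.card (Option (Fin n × Fin 4)) : ℝ) = 4 * n + 1 := by
      simp; ring
    rw [hcard, mul_left_comm]
    gcongr
  have htot : (n : ℝ) ^ k * (1 - 1 / n) ≤
      ((Finset.univ.filter fun s : Fin k → Fin n =>
        RecoversSparse Ψ r (Finset.univ.image s)).card : ℝ) := by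
    have hcover : (Finset.univ : Finset (Fin k → Fin n)) ⊆
        (Finset.univ.filter fun s => RecoversSparse Ψ r (Finset.univ.image s)) ∪
        (Finset.range (I + 1)).biUnion fun i => Finset.univ.filter fun s => ¬ good i s := by
      intro s _
      by_cases h : ∀ i ≤ I, good i s
      · exact Finset.mem_union_left _ (by simpa using hgood s h)
      · push Not at h
        obtain ⟨i, hi, h⟩ := h
        refine Finset.mem_union_right _ (Finset.mem_biUnion.2
          ⟨i, Finset.mem_range.2 (Nat.lt_succ_of_le hi), ?_⟩)
        exact Finset.mem_filter.2 ⟨Finset.mem_univ _, h⟩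
    have h1 := (Finset.card_le_card hcover).trans (Finset.card_union_le _ _)
    have h2 := h1.trans (Nat.add_le_add_left Finset.card_biUnion_le _)
    have h3 : (n : ℝ) ^ k ≤ ((Finset.univ.filter fun s : Fin k → Fin n =>
        RecoversSparse Ψ r (Finset.univ.image s)).card : ℝ) +
        ∑ i ∈ Finset.range (I + 1), ((Finset.univ.filter fun s => ¬ good i s).card : ℝ) := by
      rw [Finset.card_univ, Fintype.card_fun, Fintype.card_fin, Fintype.card_fin] at h2
      exact_mod_cast h2
    have h5 := Finset.sum_le_sum hbad
    -- There are `I + 1 ≤ k ≤ n` levels, each failing with probability at most `1/n²`.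
    have h6 : ∑ i ∈ Finset.range (I + 1), (n : ℝ) ^ k * (1 / (n : ℝ) ^ 2) ≤
        (n : ℝ) ^ k * (1 / (n : ℝ)) := by
      rw [Finset.sum_const, Finset.card_range, nsmul_eq_mul]
      push_cast
      calc (I + 1 : ℝ) * (n ^ k * (1 / n ^ 2)) ≤ n * (n ^ k * (1 / n ^ 2)) := by gcongr
        _ = _ := by field_simp
    linarith
  refine le_trans ?_ (card_sample_le_probSubset hn0 hkn fun A B hAB h => h.mono hAB)
  rw [le_div_iff₀ (by positivity)]
  linarith

/-! ### The asymptotic rate. -/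

/-- `2^I` is the first power of 2 above `2√r K`. Since `r ≥ 2`, constants and `log K` are absorbed
into a multiple of `log r`. -/
theorem exists_level_count {K : ℝ} (hK : 1 ≤ K) : ∃ E : ℝ, 0 < E ∧ ∀ r : ℕ, 2 ≤ r → ∃ I : ℕ,
    2 * Real.sqrt r * K < 2 ^ I ∧ (2 : ℝ) ^ I ≤ 4 * Real.sqrt r * K ∧
      (I + 1 : ℝ) ≤ E * Real.log r := by
  have hl2 : 0 < Real.log 2 := Real.log_pos (by norm_num)
  have hlK : 0 ≤ Real.log K := Real.log_nonneg hK
  refine ⟨(4 + Real.log K / Real.log 2) / Real.log 2, by positivity, fun r hr => ?_⟩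
  have hr' : (2 : ℝ) ≤ r := by exact_mod_cast hr
  have hs1 : 1 ≤ Real.sqrt r := Real.one_le_sqrt.2 (by linarith)
  have hlr : Real.log 2 ≤ Real.log r := Real.log_le_log (by norm_num) hr'
  obtain ⟨m, hm1, hm2⟩ := exists_nat_pow_near (x := 2 * Real.sqrt r * K) (y := 2)
    (by nlinarith) (by norm_num)
  refine ⟨m + 1, hm2, by rw [pow_succ]; linarith, ?_⟩
  have hpow : (2 : ℝ) ^ (m + 2) ≤ 2 ^ 3 * Real.sqrt r * K := by
    rw [pow_add]; linarith
  have h1 := Real.log_le_log (by positivity) hpow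
  rw [Real.log_mul (by positivity) (by positivity), Real.log_mul (by positivity) (by positivity),
    Real.log_pow, Real.log_pow, Real.log_sqrt (by positivity)] at h1
  push_cast at h1 ⊢
  have h2 : Real.log K ≤ Real.log K / Real.log 2 * Real.log r := by
    rw [div_mul_eq_mul_div, le_div_iff₀ hl2]
    gcongr
  rw [div_mul_eq_mul_div, le_div_iff₀ hl2]
  linarith

theorem exists_rate_of_bounded_unitary (K : ℝ) :
    ∃ C : ℝ, 0 < C ∧ ∃ p : ℕ → ℝ, Tendsto p atTop (𝓝 1) ∧
      ∀ n r k : ℕ, 2 ≤ n → 2 ≤ r → k ≤ n → C * sampleRate r n ≤ k →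
        ∀ Ψ ∈ Matrix.unitaryGroup (Fin n) ℂ, (∀ i j, ‖Ψ i j‖ ≤ K / Real.sqrt n) →
          p n ≤ probSubset n k (RecoversSparse Ψ r) := by
  set K' := max K 1 with hK'
  have hK1 : 1 ≤ K' := le_max_right _ _
  obtain ⟨E, hE, hlev⟩ := exists_level_count hK1
  -- As `2 log 2 > 1`, the factor `log(r log n)` is bounded below by a positive constant, which goes
  -- into `C`.
  have hc : 0 < Real.log (2 * Real.log 2) := Real.log_pos (by linarith [Real.log_two_gt_d9])
  refine ⟨3280000 * K' ^ 2 * E ^ 2 / Real.log (2 * Real.log 2), by positivity,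
    fun n => 1 - 1 / (n : ℝ), ?_, ?_⟩
  · simpa using tendsto_one_div_atTop_nhds_zero_nat.const_sub (1 : ℝ)
  intro n r k hn hr hk hkC Ψ hΨ hΨK
  obtain ⟨I, hI1, hI2, hI3⟩ := hlev r hr
  have hr' : (2 : ℝ) ≤ r := by exact_mod_cast hr
  have hn' : (2 : ℝ) ≤ n := by exact_mod_cast hn
  have hl2 : 0 < Real.log 2 := Real.log_pos (by norm_num)
  have hln : Real.log 2 ≤ Real.log n := Real.log_le_log (by norm_num) hn'
  have hln0 : 0 < Real.log n := hl2.trans_le hln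
  refine le_probSubset_recoversSparse hn (by omega) hK1 hI1 hI2 hk (le_trans ?_ hkC) hΨ
    fun i j => (hΨK i j).trans (by gcongr; exact le_max_left _ _)
  have hll : Real.log (2 * Real.log 2) ≤ Real.log (r * Real.log n) :=
    Real.log_le_log (by positivity) (by gcongr)
  rw [sampleRate, div_mul_eq_mul_div, le_div_iff₀ hc]
  calc 3280000 * (r * K' ^ 2) * (I + 1) ^ 2 * Real.log n * Real.log (2 * Real.log 2)
      ≤ 3280000 * (r * K' ^ 2) * (E * Real.log r) ^ 2 * Real.log n * Real.log (r * Real.log n) := by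
        gcongr
    _ = _ := by ring

/-! ### The Fourier matrix as the case `K = 1`. -/

theorem norm_dftMatrix_apply {n : ℕ} (ω t : Fin n) : ‖dftMatrix n ω t‖ = 1 / Real.sqrt n := by
  have : -(Complex.I * 2 * Real.pi * ((ω : ℕ) : ℂ) * ((t : ℕ) : ℂ) / (n : ℂ))
      = ((-(2 * Real.pi * (ω : ℕ) * (t : ℕ) / n) : ℝ) : ℂ) * Complex.I := by
    push_cast; ring
  rw [dftMatrix, Matrix.of_apply, this, norm_mul, Complex.norm_exp_ofReal_mul_I, mul_one, norm_div,
    norm_one, Complex.norm_real, Real.norm_of_nonneg (Real.sqrt_nonneg _)]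

theorem dftMatrix_mem_unitaryGroup {n : ℕ} (hn : 0 < n) :
    dftMatrix n ∈ Matrix.unitaryGroup (Fin n) ℂ := by
  have hn0 : (n : ℂ) ≠ 0 := by exact_mod_cast hn.ne'
  rw [Matrix.mem_unitaryGroup_iff]
  ext ω ω'
  set ζ := Complex.exp (2 * Real.pi * Complex.I / n) with hζ
  have hprim : IsPrimitiveRoot ζ n := Complex.isPrimitiveRoot_exp n hn.ne'
  set x : ℂ := ζ ^ ((ω' : ℕ) : ℤ) * (ζ ^ ((ω : ℕ) : ℤ))⁻¹ with hx
  have hζ0 : ζ ≠ 0 := Complex.exp_ne_zero _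
  -- The inner product of two rows is a geometric sum in `x = ζ^(ω' - ω)`, an `n`-th root of unity
  -- that differs from 1 for distinct rows.
  have hterm : ∀ t : Fin n, dftMatrix n ω t * star (dftMatrix n) t ω' = (1 / n) * x ^ (t : ℕ) := by
    intro t
    have hxe : x = Complex.exp (2 * Real.pi * Complex.I / n * ((ω' : ℕ) - (ω : ℕ))) := by
      rw [hx, hζ, zpow_natCast, zpow_natCast, ← Complex.exp_nat_mul, ← Complex.exp_nat_mul,
        ← Complex.exp_neg, ← Complex.exp_add]
      ring_nf
    have hsq : (Real.sqrt n : ℂ) * Real.sqrt n = n := by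
      rw [← Complex.ofReal_mul, Real.mul_self_sqrt (Nat.cast_nonneg _)]
      simp
    rw [Matrix.star_apply, dftMatrix, Matrix.of_apply, Matrix.of_apply, hxe, ← Complex.exp_nat_mul]
    simp only [RCLike.star_def, map_mul, ← Complex.exp_conj, map_neg, map_div₀, Complex.conj_I,
      Complex.conj_ofReal, map_natCast, map_one, map_ofNat]
    rw [mul_mul_mul_comm, ← Complex.exp_add, div_mul_div_comm, one_mul, hsq]
    congr 2
    ring
  rw [Matrix.mul_apply, Finset.sum_congr rfl fun t _ => hterm t, ← Finset.mul_sum,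
    Fin.sum_univ_eq_sum_range fun t => x ^ t]
  by_cases h : ω = ω'
  · subst h
    have : x = 1 := by rw [hx]; exact mul_inv_cancel₀ (zpow_ne_zero _ hζ0)
    rw [this, Matrix.one_apply_eq]
    simp [hn0]
  · have hx1 : x ≠ 1 := by
      intro h1
      rw [hx, zpow_natCast, zpow_natCast, mul_inv_eq_one₀ (pow_ne_zero _ hζ0)] at h1
      exact h (Fin.ext (hprim.pow_inj ω.2 ω'.2 h1.symm))
    have hxn : x ^ n = 1 := by
      rw [hx, mul_pow, inv_pow, zpow_natCast, zpow_natCast, ← pow_mul, ← pow_mul, mul_comm _ n,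
        mul_comm _ n, pow_mul, pow_mul, hprim.pow_eq_one]
      simp
    rw [Matrix.one_apply_ne h, geom_sum_eq hx1, hxn, sub_self, zero_div, mul_zero]

theorem theorem3p2 :
    (∃ C : ℝ, 0 < C ∧ ∃ p : ℕ → ℝ, Tendsto p atTop (𝓝 1) ∧
      ∀ n r k : ℕ, 2 ≤ n → 2 ≤ r → k ≤ n → C * sampleRate r n ≤ k →
        p n ≤ probSubset n k (RecoversSparse (dftMatrix n) r)) ∧
    (∀ K : ℝ, ∃ C : ℝ, 0 < C ∧ ∃ p : ℕ → ℝ, Tendsto p atTop (𝓝 1) ∧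
      ∀ n r k : ℕ, 2 ≤ n → 2 ≤ r → k ≤ n → C * sampleRate r n ≤ k →
        ∀ Ψ ∈ Matrix.unitaryGroup (Fin n) ℂ, (∀ i j, ‖Ψ i j‖ ≤ K / Real.sqrt n) →
          p n ≤ probSubset n k (RecoversSparse Ψ r)) := by
  refine ⟨?_, exists_rate_of_bounded_unitary⟩
  obtain ⟨C, hC, p, hp, h⟩ := exists_rate_of_bounded_unitary 1
  exact ⟨C, hC, p, hp, fun n r k hn hr hk hkC => h n r k hn hr hk hkC _
    (dftMatrix_mem_unitaryGroup (by omega)) fun i j => (norm_dftMatrix_apply i j).le⟩
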